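/- Let $\mathbb T=\mathbb R/2\pi\mathbb Z$ and let $f\in L_1(\mathbb T)$ be complex-valued, with Fourier coefficients $\widehat f_k=\frac1{2\pi}\int_{-\pi}^{\pi}f(t)e^{-ikt}\,dt$ and partial sums $s_m(f;x)=\sum_{|k|\le m}\widehat f_k e^{ikx}$. For real $\alpha>1$ let $$\sigma_n^{\alpha}(f;x)=\frac1{A_n^{\alpha}}\sum_{m=0}^{n}A_{n-m}^{\alpha-1}s_m(f;x),\qquad A_n^{\beta}=\binom{n+\beta}{n}=\frac{(\beta+1)(\beta+2)\cdots(\beta+n)}{n!},$$ be the Cesàro $(C,\alpha)$ means of its Fourier series. A point $x\in\mathbb R$ is called a $d$-point of $f$ if $F(y)=\int_0^y f(t)\,dt$ is differentiable at $x$, that is, if the finite limit $$d_f(x)=\lim_{h\to0}\frac1h\int_0^h f(x+t)\,dt$$ exists. Then for every $\alpha>1$, every $f\in L_1(\mathbb T)$ and every $d$-point $x$ of $f$, $$\lim_{n\to\infty}\sigma_n^{\alpha}(f;x)=d_f(x).$$ -/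

import Mathlib

open Filter Topology MeasureTheory

noncomputable section

/-- The circle `𝕋 = ℝ / 2πℤ`. -/
abbrev Torus : Type := AddCircle (2 * Real.pi)

instance torusPeriodPos : Fact (0 < 2 * Real.pi) := ⟨Real.two_pi_pos⟩

/-- The symmetric partial sum `s_m(f; x) = ∑_{|k| ≤ m} f̂ₖ e^{ikx}` of the Fourier series of `f`. -/
def fourierPartialSum (f : Torus → ℂ) (m : ℕ) (x : ℝ) : ℂ :=
  ∑ k ∈ Finset.Icc (-(m : ℤ)) (m : ℤ), fourierCoeff f k * fourier k (x : Torus)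

/-- The Cesàro numbers `A_n^α = binom (n + α) n = (α + 1) ⋯ (α + n) / n!`. -/
def cesaroNumber (α : ℝ) (n : ℕ) : ℝ := Ring.choose (α + n) n

/-- The `n`-th Cesàro `(C, α)` mean of a sequence `s`:
`(1 / A_n^α) ∑_{m=0}^n A_{n-m}^{α-1} s_m`. -/
def cesaroMean (α : ℝ) (s : ℕ → ℂ) (n : ℕ) : ℂ :=
  (∑ m ∈ Finset.range (n + 1), (cesaroNumber (α - 1) (n - m) : ℂ) * s m) / (cesaroNumber α n : ℂ)

/-- `x` is a `d`-point of `f` with value `d = d_f(x)`: the function `F(y) = ∫_0^y f(t) dt` has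
the derivative `d` at `x`. -/
def IsDPoint (f : Torus → ℂ) (x : ℝ) (d : ℂ) : Prop :=
  HasDerivAt (fun y : ℝ => ∫ t in (0 : ℝ)..y, f (t : Torus)) d x

end

/-! Subtracting a constant from `f` reduces to `d = 0`. The mean is then `1/2π` times the integral
of `K_n(x - y) f(y)` over `[x - π, x + π]`. At a `d`-point only the primitive `G(y) = ∫_x^y f` is
controlled, `G(x + u) = o(u)`, so the integral is taken by parts and the derivative of `K_n` must be
bounded.

For `1 < a ≤ 2` the bound is `|K_n'(t)| ≤ C n² (1 + n|t|)^(-(a+1))`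
(`exists_abs_deriv_cesaroKernel_le`). Near `0` it is trivial. Away from `0`, multiplying by `2 - 2
cos t` turns the kernel into a trigonometric sum with weights `A_j^{a-2}`, which decrease because `a
≤ 2`; Abel summation split at `J ≈ 1/|t|` handles its derivative
(`abs_sum_cesaroNumber_mul_sin_le`).

After `y = x + v/n` the integrand is dominated by a multiple of `(1 + |v|)^(-a)`, integrable exactly
because `a > 1`, and tends to `0` pointwise; the boundary terms are `O(1/n)`. For `a > 2`, `(C, a -
1)` convergence implies `(C, a)` convergence (`tendsto_cesaroMean_add_one`). -/

/-! ### Cesàro numbers and the passage from `(C, a)` to `(C, a + 1)` -/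

theorem cesaroNumber_zero_right (a : ℝ) : cesaroNumber a 0 = 1 := by
  simp [cesaroNumber]

theorem cesaroNumber_succ_eq_add (a : ℝ) (n : ℕ) :
    cesaroNumber a (n + 1) = cesaroNumber a n + cesaroNumber (a - 1) (n + 1) := by
  unfold cesaroNumber
  have h := Ring.choose_succ_succ (a + n) n
  have e1 : a + ((n + 1 : ℕ) : ℝ) = a + n + 1 := by push_cast; ring
  have e2 : a - 1 + ((n + 1 : ℕ) : ℝ) = a + n := by push_cast; ring
  rw [e1, e2, h]

theorem cesaroNumber_eq_div_factorial (a : ℝ) (n : ℕ) :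
    cesaroNumber a n = (descPochhammer ℝ n).eval (a + n) / n.factorial := by
  rw [cesaroNumber, Ring.choose_eq_smul]
  rw [← Polynomial.aeval_eq_smeval, smul_eq_mul, div_eq_inv_mul]
  congr 1
  simp [Polynomial.aeval_def, Polynomial.eval₂_eq_eval_map, descPochhammer_map]

theorem cesaroNumber_succ_eq_mul (a : ℝ) (n : ℕ) :
    cesaroNumber a (n + 1) = cesaroNumber a n * ((a + n + 1) / (n + 1)) := by
  rw [cesaroNumber_eq_div_factorial, cesaroNumber_eq_div_factorial, descPochhammer_succ_left]
  simp only [Polynomial.eval_mul, Polynomial.eval_X, Polynomial.eval_comp, Polynomial.eval_sub,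
    Polynomial.eval_one, Nat.factorial_succ]
  have e : a + ((n + 1 : ℕ) : ℝ) - 1 = a + n := by push_cast; ring
  rw [e]
  push_cast
  have : (n.factorial : ℝ) ≠ 0 := by positivity
  field_simp
  ring

theorem cesaroNumber_pos {a : ℝ} (ha : -1 < a) (n : ℕ) : 0 < cesaroNumber a n := by
  induction n with
  | zero => simp [cesaroNumber_zero_right]
  | succ n ih =>
    rw [cesaroNumber_succ_eq_mul]
    have : 0 < a + n + 1 := by
      have : (0 : ℝ) ≤ n := n.cast_nonneg
      linarith
    positivity

theorem sum_cesaroNumber (a : ℝ) (n : ℕ) :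
    ∑ m ∈ Finset.range (n + 1), cesaroNumber (a - 1) m = cesaroNumber a n := by
  induction n with
  | zero => simp [cesaroNumber_zero_right]
  | succ n ih => rw [Finset.sum_range_succ, ih, cesaroNumber_succ_eq_add a]

theorem sum_cesaroNumber_reflect (a : ℝ) (n : ℕ) :
    ∑ m ∈ Finset.range (n + 1), cesaroNumber (a - 1) (n - m) = cesaroNumber a n := by
  rw [← sum_cesaroNumber a n, ← Finset.sum_range_reflect (cesaroNumber (a - 1))]
  simp

theorem cesaroNumber_mul_add (a : ℝ) (n : ℕ) :
    cesaroNumber a n * a = cesaroNumber (a - 1) n * (a + n) := by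
  induction n with
  | zero => simp [cesaroNumber_zero_right]
  | succ n ih =>
    rw [cesaroNumber_succ_eq_mul, cesaroNumber_succ_eq_mul]
    have : (n : ℝ) + 1 ≠ 0 := by positivity
    field_simp
    push_cast
    linear_combination (a + n + 1) * ih

theorem antitone_cesaroNumber {a : ℝ} (ha : -1 < a) (ha0 : a ≤ 0) :
    Antitone (cesaroNumber a) := by
  refine antitone_nat_of_succ_le fun n => ?_
  rw [cesaroNumber_succ_eq_mul]
  refine mul_le_of_le_one_right (cesaroNumber_pos ha n).le ?_
  rw [div_le_one (by positivity)]
  linarith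

theorem monotone_cesaroNumber {a : ℝ} (ha : 0 ≤ a) : Monotone (cesaroNumber a) := by
  refine monotone_nat_of_le_succ fun n => ?_
  rw [cesaroNumber_succ_eq_mul]
  refine le_mul_of_one_le_right (cesaroNumber_pos (by linarith) n).le ?_
  rw [one_le_div (by positivity)]
  linarith

/-- Bernoulli's inequality `(1 + u)^b ≤ 1 + b u` for `0 ≤ b ≤ 1` makes `A_n^b / (n + 1)^b`
increasing, which replaces Gamma-function asymptotics. -/
theorem cesaroNumber_div_le {b : ℝ} (hb : 0 < b) (hb1 : b ≤ 1) {j n : ℕ} (h : j ≤ n) :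
    cesaroNumber b j / cesaroNumber b n ≤ (((j : ℝ) + 1) / (n + 1)) ^ b := by
  have mono : Monotone fun n : ℕ => cesaroNumber b n / ((n : ℝ) + 1) ^ b := by
    refine monotone_nat_of_le_succ fun n => ?_
    have hA := cesaroNumber_pos (show -1 < b by linarith) n
    have hn : (0 : ℝ) < n + 1 := by positivity
    rw [cesaroNumber_succ_eq_mul, div_le_div_iff₀ (by positivity) (by positivity), mul_assoc]
    refine mul_le_mul_of_nonneg_left ?_ hA.le
    have hinv : 0 ≤ 1 / ((n : ℝ) + 1) := by positivity
    have key : (1 + 1 / ((n : ℝ) + 1)) ^ b ≤ 1 + b * (1 / ((n : ℝ) + 1)) :=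
      rpow_one_add_le_one_add_mul_self (by linarith) hb.le hb1
    have e : ((n + 1 : ℕ) : ℝ) + 1 = (n + 1) * (1 + 1 / ((n : ℝ) + 1)) := by
      push_cast; field_simp
    have e' : (b + n + 1) / ((n : ℝ) + 1) = 1 + b * (1 / ((n : ℝ) + 1)) := by
      field_simp; ring
    rw [e, e', Real.mul_rpow hn.le (by positivity), mul_comm]
    gcongr
  have hA := cesaroNumber_pos (show -1 < b by linarith) n
  have := mono h
  simp only at this
  rw [div_le_div_iff₀ (by positivity) (by positivity)] at this
  rw [Real.div_rpow (by positivity) (by positivity), div_le_div_iff₀ hA (by positivity)]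
  linarith

theorem tendsto_sum_cesaroNumber {a : ℝ} (ha : 0 ≤ a) :
    Tendsto (fun n => ∑ m ∈ Finset.range n, cesaroNumber a m) atTop atTop := by
  refine tendsto_atTop_mono (fun n => ?_) (tendsto_natCast_atTop_atTop (R := ℝ))
  calc (n : ℝ) = ∑ m ∈ Finset.range n, (1 : ℝ) := by simp
    _ ≤ _ := Finset.sum_le_sum fun m _ => by
      rw [← cesaroNumber_zero_right a]; exact monotone_cesaroNumber ha (Nat.zero_le m)

/-- In generating functions: `(1 - z)^(-a-1) = (1 - z)^(-1) (1 - z)^(-a)`. -/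
theorem sum_cesaroNumber_mul_succ (a : ℝ) (s : ℕ → ℂ) (n : ℕ) :
    ∑ m ∈ Finset.range (n + 1), (cesaroNumber a (n - m) : ℂ) * s m =
      ∑ k ∈ Finset.range (n + 1), ∑ m ∈ Finset.range (k + 1),
        (cesaroNumber (a - 1) (k - m) : ℂ) * s m := by
  induction n with
  | zero => simp [cesaroNumber_zero_right]
  | succ n ih =>
    rw [Finset.sum_range_succ (fun k => ∑ m ∈ Finset.range (k + 1), _) (n + 1), ← ih,
      Finset.sum_range_succ _ (n + 1), Finset.sum_range_succ _ (n + 1), ← add_assoc, ← Finset.sum_add_distrib]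
    simp only [Nat.sub_self, cesaroNumber_zero_right]
    congr 1
    refine Finset.sum_congr rfl fun m hm => ?_
    have hm' : m ≤ n := Nat.lt_succ_iff.mp (Finset.mem_range.mp hm)
    rw [Nat.succ_sub hm', Nat.succ_eq_add_one, cesaroNumber_succ_eq_add a]
    push_cast
    ring

/-- The `(C, a + 1)` mean is the average of the `(C, a)` means with positive weights `A_i^a`, whose
sum diverges; such averaging preserves limits. -/
theorem tendsto_cesaroMean_add_one {a : ℝ} (ha : 0 ≤ a) {s : ℕ → ℂ} {d : ℂ}
    (h : Tendsto (cesaroMean a s) atTop (𝓝 d)) : Tendsto (cesaroMean (a + 1) s) atTop (𝓝 d) := by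
  have hpos : ∀ n, 0 < cesaroNumber a n := cesaroNumber_pos (by linarith)
  have hsum : Tendsto (fun n => ∑ m ∈ Finset.range (n + 1), cesaroNumber a m) atTop atTop :=
    (tendsto_sum_cesaroNumber ha).comp (tendsto_add_atTop_nat 1)
  have hS : ∀ n, (∑ m ∈ Finset.range (n + 1), cesaroNumber a m) = cesaroNumber (a + 1) n := by
    intro n
    have := sum_cesaroNumber (a + 1) n
    rwa [add_sub_cancel_right] at this
  have ho : (fun n => (cesaroNumber a n : ℂ) * (cesaroMean a s n - d)) =o[atTop]
      (cesaroNumber a) := by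
    have h0 : Tendsto (fun n => cesaroMean a s n - d) atTop (𝓝 0) := by
      simpa using h.sub_const d
    rw [Asymptotics.isLittleO_iff]
    intro c hc
    filter_upwards [(Metric.tendsto_nhds.mp h0) c hc] with n hn
    rw [dist_zero_right] at hn
    rw [norm_mul, Complex.norm_real, mul_comm]
    gcongr
  have ho' := ho.sum_range (fun n => (hpos n).le) (tendsto_sum_cesaroNumber ha)
  have ho2 := ho'.comp_tendsto (tendsto_add_atTop_nat 1)
  rw [Asymptotics.isLittleO_iff] at ho2
  rw [Metric.tendsto_nhds]
  intro ε hε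
  filter_upwards [ho2 (half_pos hε)] with n hn
  have hA : 0 < cesaroNumber (a + 1) n := cesaroNumber_pos (by linarith) n
  simp only [Function.comp_apply, hS, Real.norm_eq_abs, abs_of_pos hA] at hn
  have hAc : (cesaroNumber (a + 1) n : ℂ) ≠ 0 := by exact_mod_cast hA.ne'
  have e : cesaroMean (a + 1) s n - d =
      (∑ i ∈ Finset.range (n + 1), (cesaroNumber a i : ℂ) * (cesaroMean a s i - d)) /
        (cesaroNumber (a + 1) n : ℂ) := by
    rw [cesaroMean, add_sub_cancel_right, sum_cesaroNumber_mul_succ, eq_div_iff hAc, sub_mul,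
      div_mul_cancel₀ _ hAc, ← hS n]
    push_cast
    rw [Finset.mul_sum, ← Finset.sum_sub_distrib]
    refine Finset.sum_congr rfl fun i _ => ?_
    have hi : (cesaroNumber a i : ℂ) ≠ 0 := by exact_mod_cast (hpos i).ne'
    rw [cesaroMean]
    field_simp
  rw [dist_eq_norm, e, norm_div, Complex.norm_real, Real.norm_eq_abs, abs_of_pos hA,
    div_lt_iff₀ hA]
  refine hn.trans_lt ?_
  nlinarith

/-! ### Power sums on the unit circle with decreasing coefficients -/

theorem norm_one_sub_mul_norm_sum_le {c : ℕ → ℝ} (hc : Antitone c) (h0 : ∀ n, 0 ≤ c n) {w : ℂ}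
    (hw : ‖w‖ = 1) (n : ℕ) :
    ‖1 - w‖ * ‖∑ j ∈ Finset.range n, (c j : ℂ) * w ^ j‖ ≤ 2 * c 0 := by
  -- Abel summation: with the boundary term `c n * w ^ n` included, each step adds only `c n - c (n
  -- + 1)` to the bound, and these differences telescope.
  have key : ‖(1 - w) * ∑ j ∈ Finset.range n, (c j : ℂ) * w ^ j + c n * w ^ n‖ ≤
      2 * c 0 - c n := by
    induction n with
    | zero =>
      simp only [Finset.range_zero, Finset.sum_empty, mul_zero, zero_add, pow_zero, mul_one,
        Complex.norm_real, Real.norm_eq_abs, abs_of_nonneg (h0 0)]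
      linarith
    | succ n ih =>
      have e : (1 - w) * ∑ j ∈ Finset.range (n + 1), (c j : ℂ) * w ^ j + c (n + 1) * w ^ (n + 1) =
          ((1 - w) * ∑ j ∈ Finset.range n, (c j : ℂ) * w ^ j + c n * w ^ n) -
            ((c n - c (n + 1) : ℝ) : ℂ) * w ^ (n + 1) := by
        rw [Finset.sum_range_succ]
        push_cast
        ring
      rw [e]
      refine (norm_sub_le _ _).trans ?_
      rw [norm_mul, norm_pow, hw, one_pow, mul_one, Complex.norm_real, Real.norm_eq_abs,
        abs_of_nonneg (sub_nonneg.mpr (hc n.le_succ))]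
      linarith
  rw [← norm_mul]
  have e : (1 - w) * ∑ j ∈ Finset.range n, (c j : ℂ) * w ^ j =
      ((1 - w) * ∑ j ∈ Finset.range n, (c j : ℂ) * w ^ j + c n * w ^ n) - c n * w ^ n := by ring
  rw [e]
  refine (norm_sub_le _ _).trans ?_
  rw [norm_mul _ (w ^ n), norm_pow, hw, one_pow, mul_one, Complex.norm_real, Real.norm_eq_abs,
    abs_of_nonneg (h0 n)]
  linarith

/-- The first `J` terms are estimated trivially and the rest by Abel summation; `J` is free, to be
chosen near `1/|t|`. -/
theorem norm_sum_antitone_mul_pow_le {c : ℕ → ℝ} (hc : Antitone c) (h0 : ∀ n, 0 ≤ c n) {w : ℂ}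
    (hw : ‖w‖ = 1) (hw1 : w ≠ 1) (n J : ℕ) :
    ‖∑ j ∈ Finset.range n, (c j : ℂ) * w ^ j‖ ≤
      ∑ j ∈ Finset.range J, c j + 2 * c J / ‖1 - w‖ := by
  have hpos : 0 < ‖1 - w‖ := norm_pos_iff.mpr (sub_ne_zero.mpr hw1.symm)
  have triv : ∀ N, ‖∑ j ∈ Finset.range N, (c j : ℂ) * w ^ j‖ ≤ ∑ j ∈ Finset.range N, c j := by
    intro N
    refine (norm_sum_le _ _).trans (Finset.sum_le_sum fun j _ => ?_)
    rw [norm_mul, norm_pow, hw, one_pow, mul_one, Complex.norm_real, Real.norm_eq_abs,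
      abs_of_nonneg (h0 j)]
  have hJ : 0 ≤ 2 * c J / ‖1 - w‖ := by
    have := h0 J
    positivity
  rcases le_total n J with h | h
  · have : ∑ j ∈ Finset.range n, c j ≤ ∑ j ∈ Finset.range J, c j :=
      Finset.sum_le_sum_of_subset_of_nonneg (Finset.range_mono h) fun j _ _ => h0 j
    linarith [triv n]
  · obtain ⟨k, rfl⟩ := Nat.exists_eq_add_of_le h
    rw [Finset.sum_range_add]
    refine (norm_add_le _ _).trans (add_le_add (triv J) ?_)
    rw [le_div_iff₀ hpos, mul_comm]
    have hc' : Antitone fun j => c (J + j) := fun i j hij => hc (Nat.add_le_add_left hij J)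
    have := norm_one_sub_mul_norm_sum_le hc' (fun j => h0 _) hw k
    have e : ∑ x ∈ Finset.range k, (c (J + x) : ℂ) * w ^ (J + x) =
        w ^ J * ∑ x ∈ Finset.range k, (c (J + x) : ℂ) * w ^ x := by
      rw [Finset.mul_sum]
      exact Finset.sum_congr rfl fun x _ => by rw [pow_add]; ring
    rw [e, norm_mul (w ^ J), norm_pow, hw, one_pow, one_mul]
    exact this

/-! ### Dirichlet kernels and their Cesàro sums -/

theorem sq_div_pi_le_two_sub_two_cos {t : ℝ} (ht : |t| ≤ Real.pi) :
    4 * |t| ^ 2 / Real.pi ^ 2 ≤ 2 - 2 * Real.cos t := by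
  have := Real.cos_le_one_sub_mul_cos_sq ht
  rw [sq_abs]
  have e : 4 * t ^ 2 / Real.pi ^ 2 = 2 * (2 / Real.pi ^ 2 * t ^ 2) := by ring
  linarith

theorem norm_one_sub_exp_sq (t : ℝ) :
    ‖1 - Complex.exp (-(t * Complex.I))‖ ^ 2 = 2 - 2 * Real.cos t := by
  rw [Complex.sq_norm, Complex.normSq_apply]
  have h1 : (Complex.exp (-(t * Complex.I))).re = Real.cos t := by
    rw [Complex.exp_re]; simp
  have h2 : (Complex.exp (-(t * Complex.I))).im = -Real.sin t := by
    rw [Complex.exp_im]; simp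
  simp only [Complex.sub_re, Complex.sub_im, Complex.one_re, Complex.one_im, h1, h2]
  nlinarith [Real.sin_sq_add_cos_sq t]

/-- The Dirichlet kernel `1 + 2 ∑_{k=1}^m cos (k t)`. -/
noncomputable def dirichletKernel (m : ℕ) (t : ℝ) : ℝ :=
  1 + 2 * ∑ k ∈ Finset.range m, Real.cos ((k + 1 : ℕ) * t)

theorem two_sub_two_cos_mul_dirichletKernel (m : ℕ) (t : ℝ) :
    (2 - 2 * Real.cos t) * dirichletKernel m t =
      2 * Real.cos (m * t) - 2 * Real.cos ((m + 1 : ℕ) * t) := by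
  induction m with
  | zero => simp [dirichletKernel]
  | succ m ih =>
    have e : dirichletKernel (m + 1) t =
        dirichletKernel m t + 2 * Real.cos ((m + 1 : ℕ) * t) := by
      simp only [dirichletKernel, Finset.sum_range_succ]; ring
    have e1 : ((m + 1 + 1 : ℕ) : ℝ) * t = (m + 1 : ℕ) * t + t := by push_cast; ring
    have e2 : (m : ℝ) * t = (m + 1 : ℕ) * t - t := by push_cast; ring
    rw [e, mul_add, ih, e1, e2, Real.cos_add, Real.cos_sub]
    ring

theorem hasDerivAt_dirichletKernel (m : ℕ) (t : ℝ) :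
    HasDerivAt (dirichletKernel m)
      (-2 * ∑ k ∈ Finset.range m, ((k + 1 : ℕ) : ℝ) * Real.sin ((k + 1 : ℕ) * t)) t := by
  have h : ∀ k ∈ Finset.range m, HasDerivAt (fun t : ℝ => Real.cos ((k + 1 : ℕ) * t))
      (-Real.sin ((k + 1 : ℕ) * t) * (((k + 1 : ℕ) : ℝ) * 1)) t := fun k _ =>
    (Real.hasDerivAt_cos _).comp t ((hasDerivAt_id t).const_mul _)
  have := ((HasDerivAt.fun_sum h).const_mul 2).const_add 1
  refine this.congr_deriv ?_
  rw [Finset.mul_sum, Finset.mul_sum]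
  exact Finset.sum_congr rfl fun k _ => by ring

/-- The sum `∑_{m=0}^n A_{n-m}^β D_m`, the kernel of the `(C, β + 1)` mean up to normalisation. -/
noncomputable def cesaroDirichletSum (b : ℝ) (n : ℕ) (t : ℝ) : ℝ :=
  ∑ m ∈ Finset.range (n + 1), cesaroNumber b (n - m) * dirichletKernel m t

/-- Summation by parts: a difference in the sequence is traded for weights of order one lower. -/
theorem sum_cesaroNumber_mul_sub (b : ℝ) (c : ℕ → ℝ) (n : ℕ) :
    ∑ m ∈ Finset.range (n + 1), cesaroNumber b (n - m) * (c m - c (m + 1)) =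
      cesaroNumber b n * c 0 -
        ∑ m ∈ Finset.range (n + 1), cesaroNumber (b - 1) (n - m) * c (m + 1) := by
  have h1 : ∑ m ∈ Finset.range (n + 1), cesaroNumber b (n - m) * c m =
      ∑ m ∈ Finset.range n, cesaroNumber b (n - (m + 1)) * c (m + 1) + cesaroNumber b n * c 0 := by
    rw [Finset.sum_range_succ']; simp
  have h2 : ∑ m ∈ Finset.range (n + 1), cesaroNumber b (n - m) * c (m + 1) =
      ∑ m ∈ Finset.range n, cesaroNumber b (n - (m + 1)) * c (m + 1) +
        ∑ m ∈ Finset.range (n + 1), cesaroNumber (b - 1) (n - m) * c (m + 1) := by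
    rw [Finset.sum_range_succ, Finset.sum_range_succ _ n, ← add_assoc, ← Finset.sum_add_distrib]
    simp only [Nat.sub_self, cesaroNumber_zero_right]
    congr 1
    refine Finset.sum_congr rfl fun m hm => ?_
    have hm' := Finset.mem_range.mp hm
    obtain ⟨k, hk⟩ : ∃ k, n - m = k + 1 := ⟨n - m - 1, by omega⟩
    have hk' : n - (m + 1) = k := by omega
    rw [hk, hk', cesaroNumber_succ_eq_add b]
    ring
  simp only [mul_sub, Finset.sum_sub_distrib]
  rw [h1, h2]
  ring

theorem two_sub_two_cos_mul_cesaroDirichletSum (b : ℝ) (n : ℕ) (t : ℝ) :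
    (2 - 2 * Real.cos t) * cesaroDirichletSum b n t = 2 * cesaroNumber b n -
      2 * ∑ m ∈ Finset.range (n + 1), cesaroNumber (b - 1) (n - m) * Real.cos ((m + 1 : ℕ) * t) := by
  have h := sum_cesaroNumber_mul_sub b (fun m => 2 * Real.cos (m * t)) n
  rw [cesaroDirichletSum, Finset.mul_sum]
  have e : ∀ m ∈ Finset.range (n + 1), (2 - 2 * Real.cos t) *
      (cesaroNumber b (n - m) * dirichletKernel m t) =
      cesaroNumber b (n - m) * (2 * Real.cos (m * t) - 2 * Real.cos ((m + 1 : ℕ) * t)) := by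
    intro m _
    rw [← two_sub_two_cos_mul_dirichletKernel]; ring
  rw [Finset.sum_congr rfl e, h, Finset.mul_sum]
  simp only [Nat.cast_zero, zero_mul, Real.cos_zero, mul_one]
  rw [mul_comm]
  congr 1
  exact Finset.sum_congr rfl fun m _ => by ring

theorem two_sub_two_cos_mul_abs_cesaroDirichletSum_le {b : ℝ} (hb : 0 < b) (n : ℕ) (t : ℝ) :
    (2 - 2 * Real.cos t) * |cesaroDirichletSum b n t| ≤ 4 * cesaroNumber b n := by
  have h0 : 0 ≤ 2 - 2 * Real.cos t := by linarith [Real.cos_le_one t]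
  rw [← abs_of_nonneg h0, ← abs_mul, two_sub_two_cos_mul_cesaroDirichletSum]
  have hA := cesaroNumber_pos (show -1 < b by linarith) n
  have hs : |∑ m ∈ Finset.range (n + 1),
      cesaroNumber (b - 1) (n - m) * Real.cos ((m + 1 : ℕ) * t)| ≤ cesaroNumber b n := by
    rw [← sum_cesaroNumber_reflect b n]
    refine (Finset.abs_sum_le_sum_abs _ _).trans (Finset.sum_le_sum fun m _ => ?_)
    have hp := cesaroNumber_pos (show -1 < b - 1 by linarith) (n - m)
    rw [abs_mul, abs_of_pos hp]
    exact mul_le_of_le_one_right hp.le (Real.abs_cos_le_one _)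
  rw [abs_le] at hs ⊢
  constructor <;> linarith [hs.1, hs.2]

theorem hasDerivAt_cesaroDirichletSum (b : ℝ) (n : ℕ) (t : ℝ) :
    HasDerivAt (cesaroDirichletSum b n) (∑ m ∈ Finset.range (n + 1), cesaroNumber b (n - m) *
      (-2 * ∑ k ∈ Finset.range m, ((k + 1 : ℕ) : ℝ) * Real.sin ((k + 1 : ℕ) * t))) t :=
  HasDerivAt.fun_sum fun m _ => (hasDerivAt_dirichletKernel m t).const_mul _

/-- Both sides of `two_sub_two_cos_mul_cesaroDirichletSum` are differentiated and the derivatives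
identified by uniqueness, so no quotient appears. -/
theorem two_sub_two_cos_mul_deriv_cesaroDirichletSum (b : ℝ) (n : ℕ) (t : ℝ) :
    (2 - 2 * Real.cos t) * deriv (cesaroDirichletSum b n) t =
      2 * ∑ m ∈ Finset.range (n + 1), cesaroNumber (b - 1) (n - m) *
        (((m + 1 : ℕ) : ℝ) * Real.sin ((m + 1 : ℕ) * t)) -
        2 * Real.sin t * cesaroDirichletSum b n t := by
  have hU := (hasDerivAt_cesaroDirichletSum b n t).differentiableAt.hasDerivAt
  have hL := (((Real.hasDerivAt_cos t).const_mul 2).const_sub 2).mul hU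
  have h : ∀ m ∈ Finset.range (n + 1), HasDerivAt
      (fun t : ℝ => cesaroNumber (b - 1) (n - m) * Real.cos ((m + 1 : ℕ) * t))
      (cesaroNumber (b - 1) (n - m) *
        (-Real.sin ((m + 1 : ℕ) * t) * (((m + 1 : ℕ) : ℝ) * 1))) t := fun m _ =>
    ((Real.hasDerivAt_cos _).comp t ((hasDerivAt_id t).const_mul _)).const_mul _
  have hR := ((HasDerivAt.fun_sum h).const_mul 2).const_sub (2 * cesaroNumber b n)
  have hL' := hL.congr_of_eventuallyEq
    (Eventually.of_forall fun t => (two_sub_two_cos_mul_cesaroDirichletSum b n t).symm)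
  have e := hL'.unique hR
  have e2 : ∑ m ∈ Finset.range (n + 1), cesaroNumber (b - 1) (n - m) *
        (-Real.sin ((m + 1 : ℕ) * t) * (((m + 1 : ℕ) : ℝ) * 1)) =
      -∑ m ∈ Finset.range (n + 1), cesaroNumber (b - 1) (n - m) *
        (((m + 1 : ℕ) : ℝ) * Real.sin ((m + 1 : ℕ) * t)) := by
    rw [← Finset.sum_neg_distrib]
    exact Finset.sum_congr rfl fun m _ => by ring
  rw [e2] at e
  linear_combination e

/-- Reversing the summation gives the imaginary part of a unimodular factor times `∑ c_j w^j`, `w =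
e^{-it}`, `c_j = (n + 1 - j) A_j^{b-1}`. Both factors of `c_j` are nonnegative and decreasing, the
second because `b ≤ 1`, so the split Abel bound applies. -/
theorem abs_sum_cesaroNumber_mul_sin_le {b : ℝ} (hb : 0 < b) (hb1 : b ≤ 1) (n J : ℕ) {t : ℝ}
    (ht : |t| ≤ Real.pi) (ht0 : t ≠ 0) (hJ : 1 / |t| ≤ J) :
    |∑ m ∈ Finset.range (n + 1), cesaroNumber (b - 1) (n - m) *
        (((m + 1 : ℕ) : ℝ) * Real.sin ((m + 1 : ℕ) * t))| ≤
      (n + 1) * cesaroNumber b J * (1 + Real.pi) := by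
  have hτ : 0 < |t| := abs_pos.mpr ht0
  have hπ := Real.pi_pos
  set w := Complex.exp (-(t * Complex.I)) with hw
  set c : ℕ → ℝ := fun j => ((n + 1 - j : ℕ) : ℝ) * cesaroNumber (b - 1) j with hcdef
  have hApos : ∀ j, 0 < cesaroNumber (b - 1) j := cesaroNumber_pos (by linarith)
  have hc0 : ∀ j, 0 ≤ c j := fun j => mul_nonneg (Nat.cast_nonneg _) (hApos j).le
  have hcle : ∀ j, c j ≤ (n + 1) * cesaroNumber (b - 1) j := fun j => by
    refine mul_le_mul_of_nonneg_right ?_ (hApos j).le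
    exact_mod_cast Nat.sub_le _ _
  have hc : Antitone c := fun i j hij => mul_le_mul
    (by exact_mod_cast Nat.sub_le_sub_left hij _)
    (antitone_cesaroNumber (by linarith) (by linarith) hij) (hApos j).le (Nat.cast_nonneg _)
  have hwn : ‖w‖ = 1 := by
    rw [hw, ← neg_mul, ← Complex.ofReal_neg]; exact Complex.norm_exp_ofReal_mul_I _
  have hwd : 2 * |t| / Real.pi ≤ ‖1 - w‖ := by
    refine le_of_sq_le_sq ?_ (norm_nonneg _)
    rw [norm_one_sub_exp_sq, div_pow, mul_pow]
    have := sq_div_pi_le_two_sub_two_cos ht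
    norm_num at this ⊢
    exact this
  have hwd0 : 0 < 2 * |t| / Real.pi := by positivity
  have hw1 : w ≠ 1 := by
    intro h
    rw [h, sub_self, norm_zero] at hwd
    linarith
  have key := norm_sum_antitone_mul_pow_le hc hc0 hwn hw1 (n + 1) J
  have hsum : ∑ j ∈ Finset.range J, c j ≤ (n + 1) * cesaroNumber b J := by
    calc ∑ j ∈ Finset.range J, c j ≤ ∑ j ∈ Finset.range J, (n + 1) * cesaroNumber (b - 1) j :=
          Finset.sum_le_sum fun j _ => hcle j
      _ = (n + 1) * ∑ j ∈ Finset.range J, cesaroNumber (b - 1) j := by rw [Finset.mul_sum]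
      _ ≤ _ := by
        refine mul_le_mul_of_nonneg_left ?_ (by positivity)
        rw [← sum_cesaroNumber b J, Finset.sum_range_succ]
        linarith [hApos J]
  have hBpos := cesaroNumber_pos (show -1 < b by linarith) J
  -- Since `J |t| ≥ 1`, the tail of the Abel bound has the same size as its head.
  have hAJ : cesaroNumber (b - 1) J ≤ cesaroNumber b J * |t| := by
    have e := cesaroNumber_mul_add b J
    rw [div_le_iff₀ hτ] at hJ
    calc cesaroNumber (b - 1) J = cesaroNumber (b - 1) J * 1 := by ring
      _ ≤ cesaroNumber (b - 1) J * ((b + J) * |t|) := by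
        refine mul_le_mul_of_nonneg_left ?_ (hApos J).le
        nlinarith
      _ = cesaroNumber b J * b * |t| := by rw [e]; ring
      _ ≤ cesaroNumber b J * |t| := by
        refine mul_le_mul_of_nonneg_right ?_ hτ.le
        exact mul_le_of_le_one_right hBpos.le hb1
  have hfrac : 2 * c J / ‖1 - w‖ ≤ (n + 1) * cesaroNumber b J * Real.pi := by
    have h1 : c J ≤ (n + 1) * (cesaroNumber b J * |t|) :=
      (hcle J).trans (mul_le_mul_of_nonneg_left hAJ (by positivity))
    calc 2 * c J / ‖1 - w‖ ≤ 2 * ((n + 1) * (cesaroNumber b J * |t|)) / (2 * |t| / Real.pi) := by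
          gcongr
      _ = _ := by field_simp
  have hS : ∑ m ∈ Finset.range (n + 1), cesaroNumber (b - 1) (n - m) *
        (((m + 1 : ℕ) : ℝ) * Real.sin ((m + 1 : ℕ) * t)) =
      (Complex.exp ((((n + 1 : ℕ) * t : ℝ) : ℂ) * Complex.I) *
        ∑ j ∈ Finset.range (n + 1), (c j : ℂ) * w ^ j).im := by
    rw [Finset.mul_sum, Complex.im_sum, ← Finset.sum_range_reflect]
    refine Finset.sum_congr rfl fun j hj => ?_
    have hj' : j ≤ n := Nat.lt_succ_iff.mp (Finset.mem_range.mp hj)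
    have i1 : n + 1 - 1 - j = n - j := by omega
    have i2 : n - (n - j) = j := by omega
    have i3 : n - j + 1 = n + 1 - j := by omega
    have e : Complex.exp ((((n + 1 : ℕ) * t : ℝ) : ℂ) * Complex.I) * ((c j : ℂ) * w ^ j) =
        (c j : ℂ) * Complex.exp ((((n + 1 - j : ℕ) * t : ℝ) : ℂ) * Complex.I) := by
      rw [hw, ← Complex.exp_nat_mul, mul_left_comm, ← Complex.exp_add,
        Nat.cast_sub (hj'.trans n.le_succ)]
      push_cast
      ring_nf
    rw [e, i1, i2, i3, Complex.im_ofReal_mul, Complex.exp_ofReal_mul_I_im]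
    ring
  rw [hS]
  refine (Complex.abs_im_le_norm _).trans ?_
  rw [norm_mul, Complex.norm_exp_ofReal_mul_I, one_mul]
  refine key.trans ?_
  linarith

/-! ### Estimates for the Cesàro kernel and its derivative -/

/-- The kernel of the Cesàro `(C, a)` mean. -/
noncomputable def cesaroKernel (a : ℝ) (n : ℕ) (t : ℝ) : ℝ :=
  cesaroDirichletSum (a - 1) n t / cesaroNumber a n

theorem deriv_cesaroKernel (a : ℝ) (n : ℕ) (t : ℝ) :
    deriv (cesaroKernel a n) t = deriv (cesaroDirichletSum (a - 1) n) t / cesaroNumber a n :=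
  deriv_div_const _

theorem contDiff_cesaroKernel (a : ℝ) (n : ℕ) : ContDiff ℝ 1 (cesaroKernel a n) := by
  unfold cesaroKernel cesaroDirichletSum dirichletKernel
  fun_prop

/-- Here `2 - 2 cos t = 4`, which leaves `A_n^{a-1} / A_n^a = a / (a + n)`. This controls the
boundary terms at `±π`. -/
theorem abs_cesaroKernel_pi_le {a : ℝ} (ha : 1 < a) {n : ℕ} {t : ℝ} (ht : Real.cos t = -1) :
    |cesaroKernel a n t| ≤ a / (a + n) := by
  have h := two_sub_two_cos_mul_abs_cesaroDirichletSum_le (show 0 < a - 1 by linarith) n t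
  have hA := cesaroNumber_pos (show -1 < a by linarith) n
  have e := cesaroNumber_mul_add a n
  have hn : 0 < a + n := by positivity
  rw [cesaroKernel, abs_div, abs_of_pos hA, div_le_div_iff₀ hA hn]
  rw [ht] at h
  nlinarith

theorem abs_deriv_cesaroKernel_le_sq {a : ℝ} (ha : 0 < a) (n : ℕ) (t : ℝ) :
    |deriv (cesaroKernel a n) t| ≤ 2 * (n : ℝ) ^ 2 := by
  have hA := cesaroNumber_pos (show -1 < a by linarith) n
  rw [deriv_cesaroKernel, (hasDerivAt_cesaroDirichletSum _ n t).deriv, abs_div, abs_of_pos hA,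
    div_le_iff₀ hA, ← sum_cesaroNumber_reflect a n, Finset.mul_sum]
  refine (Finset.abs_sum_le_sum_abs _ _).trans (Finset.sum_le_sum fun m hm => ?_)
  have hm' : m ≤ n := Nat.lt_succ_iff.mp (Finset.mem_range.mp hm)
  have hp := cesaroNumber_pos (show -1 < a - 1 by linarith) (n - m)
  rw [abs_mul, abs_of_pos hp, mul_comm]
  refine mul_le_mul_of_nonneg_right ?_ hp.le
  rw [abs_mul]
  have : |∑ k ∈ Finset.range m, ((k + 1 : ℕ) : ℝ) * Real.sin ((k + 1 : ℕ) * t)| ≤ n ^ 2 := by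
    calc _ ≤ ∑ k ∈ Finset.range m, (n : ℝ) := by
          refine (Finset.abs_sum_le_sum_abs _ _).trans (Finset.sum_le_sum fun k hk => ?_)
          have hk' := Finset.mem_range.mp hk
          rw [abs_mul, Nat.abs_cast]
          refine (mul_le_of_le_one_right (Nat.cast_nonneg _) (Real.abs_sin_le_one _)).trans ?_
          exact_mod_cast (show k + 1 ≤ n by omega)
      _ = m * n := by simp
      _ ≤ n ^ 2 := by
        rw [sq]
        gcongr
  norm_num
  simpa using this

theorem abs_deriv_cesaroDirichletSum_le {b : ℝ} (hb : 0 < b) (hb1 : b ≤ 1) (n J : ℕ) {t : ℝ}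
    (ht : |t| ≤ Real.pi) (ht0 : t ≠ 0) (hJ : 1 / |t| ≤ J) :
    |deriv (cesaroDirichletSum b n) t| ≤
      (1 + Real.pi) * Real.pi ^ 2 * ((n + 1) * cesaroNumber b J) / |t| ^ 2 +
        Real.pi ^ 4 * cesaroNumber b n / |t| ^ 3 := by
  have hτ : 0 < |t| := abs_pos.mpr ht0
  have hπ := Real.pi_pos
  have hA := cesaroNumber_pos (show -1 < b by linarith) n
  have hB := cesaroNumber_pos (show -1 < b by linarith) J
  set q := 2 - 2 * Real.cos t with hq
  set r := 4 * |t| ^ 2 / Real.pi ^ 2 with hr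
  have hr0 : 0 < r := by positivity
  have hqr : r ≤ q := sq_div_pi_le_two_sub_two_cos ht
  have hq0 : 0 < q := hr0.trans_le hqr
  have hU : |cesaroDirichletSum b n t| ≤ 4 * cesaroNumber b n / r := by
    have := two_sub_two_cos_mul_abs_cesaroDirichletSum_le hb n t
    rw [le_div_iff₀ hr0, mul_comm]
    exact (mul_le_mul_of_nonneg_right hqr (abs_nonneg _)).trans this
  have hS := abs_sum_cesaroNumber_mul_sin_le hb hb1 n J ht ht0 hJ
  have e := two_sub_two_cos_mul_deriv_cesaroDirichletSum b n t
  set S := ∑ m ∈ Finset.range (n + 1), cesaroNumber (b - 1) (n - m) *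
        (((m + 1 : ℕ) : ℝ) * Real.sin ((m + 1 : ℕ) * t))
  have hbound : |q * deriv (cesaroDirichletSum b n) t| ≤
      2 * ((n + 1) * cesaroNumber b J * (1 + Real.pi)) + 2 * |t| * (4 * cesaroNumber b n / r) := by
    rw [e]
    refine (abs_sub _ _).trans ?_
    rw [abs_mul, abs_mul, abs_mul, abs_two]
    have := Real.abs_sin_le_abs (x := t)
    gcongr
  rw [abs_mul, abs_of_pos hq0] at hbound
  have h1 : r * |deriv (cesaroDirichletSum b n) t| ≤ _ :=
    (mul_le_mul_of_nonneg_right hqr (abs_nonneg _)).trans hbound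
  rw [← le_div_iff₀' hr0] at h1
  refine h1.trans ?_
  -- The constants come out as half of those claimed.
  have e2 : (2 * ((n + 1) * cesaroNumber b J * (1 + Real.pi)) +
      2 * |t| * (4 * cesaroNumber b n / r)) / r =
      (1 + Real.pi) * Real.pi ^ 2 * ((n + 1) * cesaroNumber b J) / |t| ^ 2 / 2 +
        Real.pi ^ 4 * cesaroNumber b n / |t| ^ 3 / 2 := by
    rw [hr]; field_simp; ring
  rw [e2]
  have p1 : 0 ≤ (1 + Real.pi) * Real.pi ^ 2 * ((n + 1) * cesaroNumber b J) / |t| ^ 2 := by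
    positivity
  have p2 : 0 ≤ Real.pi ^ 4 * cesaroNumber b n / |t| ^ 3 := by positivity
  linarith

theorem abs_deriv_cesaroKernel_le_of_one_le {a : ℝ} (ha : 1 < a) (ha2 : a ≤ 2) {n : ℕ} {t : ℝ}
    (ht : |t| ≤ Real.pi) (hnt : 1 ≤ n * |t|) :
    |deriv (cesaroKernel a n) t| ≤
      (2 * ((1 + Real.pi) * Real.pi ^ 2 * (1 + 2 * Real.pi)) + 2 * Real.pi ^ 4) *
        (n : ℝ) ^ 2 * (n * |t|) ^ (-(a + 1)) := by
  have hπ := Real.pi_pos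
  have ht0 : t ≠ 0 := by
    rintro rfl
    norm_num at hnt
  have hτ : 0 < |t| := abs_pos.mpr ht0
  have hn0 : (0 : ℝ) < n := by
    by_contra h
    have : (n : ℝ) = 0 := le_antisymm (not_lt.mp h) n.cast_nonneg
    rw [this] at hnt; norm_num at hnt
  set x := (n : ℝ) * |t| with hx
  have hx0 : 0 < x := by linarith
  set J := ⌈1 / |t|⌉₊ with hJdef
  have hJ : 1 / |t| ≤ J := Nat.le_ceil _
  have hJn : J ≤ n := by
    rw [hJdef, Nat.ceil_le, div_le_iff₀ hτ]; exact hnt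
  -- `J + 1 ≤ 1/|t| + 2`, and `2 ≤ 2π/|t|` because `|t| ≤ π`.
  have hJ2 : (J : ℝ) + 1 ≤ (1 + 2 * Real.pi) / |t| := by
    have h1 := (Nat.ceil_lt_add_one (show 0 ≤ 1 / |t| by positivity)).le
    have h2 : 2 ≤ 2 * Real.pi / |t| := by rw [le_div_iff₀ hτ]; linarith
    rw [add_div]; linarith
  have hb : 0 < a - 1 := by linarith
  have h := abs_deriv_cesaroDirichletSum_le hb (by linarith) n J ht ht0 hJ
  have hA := cesaroNumber_pos (show -1 < a by linarith) n
  have hA' := cesaroNumber_pos (show -1 < a - 1 by linarith) n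
  have hB := cesaroNumber_pos (show -1 < a - 1 by linarith) J
  have hratio : cesaroNumber (a - 1) J / cesaroNumber (a - 1) n ≤
      (1 + 2 * Real.pi) * x ^ (-(a - 1)) := by
    calc _ ≤ (((J : ℝ) + 1) / (n + 1)) ^ (a - 1) := cesaroNumber_div_le hb (by linarith) hJn
      _ ≤ ((1 + 2 * Real.pi) / x) ^ (a - 1) := by
        refine Real.rpow_le_rpow (by positivity) ?_ hb.le
        calc ((J : ℝ) + 1) / (n + 1) ≤ ((1 + 2 * Real.pi) / |t|) / n := by gcongr; linarith
          _ = _ := by rw [hx]; field_simp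
      _ = (1 + 2 * Real.pi) ^ (a - 1) * x ^ (-(a - 1)) := by
        rw [Real.div_rpow (by positivity) hx0.le, Real.rpow_neg hx0.le, div_eq_mul_inv]
      _ ≤ _ := by
        gcongr
        exact Real.rpow_le_self_of_one_le (by linarith) (by linarith)
  have hAA : cesaroNumber (a - 1) n * (n + 1) ≤ 2 * cesaroNumber a n := by
    have := cesaroNumber_mul_add a n
    nlinarith
  rw [deriv_cesaroKernel, abs_div, abs_of_pos hA, div_le_iff₀ hA]
  refine h.trans ?_
  have e1 : (n : ℝ) ^ 2 * x ^ (-(a + 1)) = x ^ (-(a - 1)) / |t| ^ 2 := by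
    have : -(a + 1) = -(a - 1) - (2 : ℕ) := by push_cast; ring
    rw [this, Real.rpow_sub_natCast hx0.ne', hx]
    field_simp
  -- For `a ≤ 2` and `x ≥ 1` the `|t|⁻³` term, of relative order `x⁻¹`, is absorbed by the main term
  -- of order `x^(-(a-1))`.
  have e2 : 1 / |t| ^ 3 ≤ n * (x ^ (-(a - 1)) / |t| ^ 2) := by
    have h1 : x⁻¹ ≤ x ^ (-(a - 1)) := by
      rw [← Real.rpow_neg_one]
      exact Real.rpow_le_rpow_of_exponent_le hnt (by linarith)
    calc 1 / |t| ^ 3 = n * (x⁻¹ / |t| ^ 2) := by rw [hx]; field_simp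
      _ ≤ _ := by gcongr
  rw [mul_assoc _ ((n : ℝ) ^ 2), e1]
  set y := x ^ (-(a - 1)) / |t| ^ 2 with hy
  have hy0 : 0 < y := by positivity
  rw [div_le_iff₀ hA'] at hratio
  have t1 : (1 + Real.pi) * Real.pi ^ 2 * ((n + 1) * cesaroNumber (a - 1) J) / |t| ^ 2 ≤
      2 * ((1 + Real.pi) * Real.pi ^ 2 * (1 + 2 * Real.pi)) * y * cesaroNumber a n := by
    calc _ ≤ (1 + Real.pi) * Real.pi ^ 2 *
          ((n + 1) * ((1 + 2 * Real.pi) * x ^ (-(a - 1)) * cesaroNumber (a - 1) n)) / |t| ^ 2 := by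
          gcongr
      _ = (1 + Real.pi) * Real.pi ^ 2 * (1 + 2 * Real.pi) * y *
          (cesaroNumber (a - 1) n * (n + 1)) := by rw [hy]; ring
      _ ≤ (1 + Real.pi) * Real.pi ^ 2 * (1 + 2 * Real.pi) * y * (2 * cesaroNumber a n) := by gcongr
      _ = _ := by ring
  have t2 : Real.pi ^ 4 * cesaroNumber (a - 1) n / |t| ^ 3 ≤
      2 * Real.pi ^ 4 * y * cesaroNumber a n := by
    calc _ = Real.pi ^ 4 * cesaroNumber (a - 1) n * (1 / |t| ^ 3) := by ring
      _ ≤ Real.pi ^ 4 * cesaroNumber (a - 1) n * ((n + 1) * y) := by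
        gcongr
        refine e2.trans ?_
        gcongr
        linarith
      _ = Real.pi ^ 4 * y * (cesaroNumber (a - 1) n * (n + 1)) := by ring
      _ ≤ Real.pi ^ 4 * y * (2 * cesaroNumber a n) := by gcongr
      _ = _ := by ring
  linarith

/-- With `x = n|t|`, the decay bound covers `x ≥ 1`, where `1 + x ≤ 2x`, and the trivial bound `2n²`
covers `x ≤ 1`, where `1 + x ≤ 2`; hence the factor `2^(a+1)`. -/
theorem exists_abs_deriv_cesaroKernel_le {a : ℝ} (ha : 1 < a) (ha2 : a ≤ 2) :
    ∃ C, 0 ≤ C ∧ ∀ (n : ℕ) (t : ℝ), |t| ≤ Real.pi →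
      |deriv (cesaroKernel a n) t| ≤ C * (n : ℝ) ^ 2 * (1 + n * |t|) ^ (-(a + 1)) := by
  have hπ := Real.pi_pos
  set C := 2 * ((1 + Real.pi) * Real.pi ^ 2 * (1 + 2 * Real.pi)) + 2 * Real.pi ^ 4 with hC
  have hC2 : 0 ≤ C := by positivity
  refine ⟨(2 + C) * 2 ^ (a + 1), by positivity, fun n t ht => ?_⟩
  have hx0 : 0 ≤ (n : ℝ) * |t| := by positivity
  set x := (n : ℝ) * |t| with hx
  have two : (2 : ℝ) ^ (a + 1) * 2 ^ (-(a + 1)) = 1 := by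
    rw [← Real.rpow_add two_pos]; simp
  rcases le_total 1 x with h | h
  · refine (abs_deriv_cesaroKernel_le_of_one_le ha ha2 ht h).trans ?_
    have : x ^ (-(a + 1)) ≤ 2 ^ (a + 1) * (1 + x) ^ (-(a + 1)) := by
      have h1 : (2 * x) ^ (-(a + 1)) ≤ (1 + x) ^ (-(a + 1)) :=
        Real.rpow_le_rpow_of_nonpos (by linarith) (by linarith) (by linarith)
      calc x ^ (-(a + 1)) = 2 ^ (a + 1) * (2 * x) ^ (-(a + 1)) := by
            rw [Real.mul_rpow two_pos.le hx0, ← mul_assoc, two, one_mul]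
        _ ≤ _ := by gcongr
    calc C * (n : ℝ) ^ 2 * x ^ (-(a + 1))
        ≤ (2 + C) * (n : ℝ) ^ 2 * (2 ^ (a + 1) * (1 + x) ^ (-(a + 1))) := by gcongr; linarith
      _ = _ := by ring
  · refine (abs_deriv_cesaroKernel_le_sq (by linarith) n t).trans ?_
    have h1 : (2 : ℝ) ^ (-(a + 1)) ≤ (1 + x) ^ (-(a + 1)) :=
      Real.rpow_le_rpow_of_nonpos (by linarith) (by linarith) (by linarith)
    calc 2 * (n : ℝ) ^ 2 ≤ (2 + C) * (n : ℝ) ^ 2 * (2 ^ (a + 1) * 2 ^ (-(a + 1))) := by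
          rw [two, mul_one]; gcongr; linarith
      _ ≤ (2 + C) * (n : ℝ) ^ 2 * (2 ^ (a + 1) * (1 + x) ^ (-(a + 1))) := by gcongr
      _ = _ := by ring

/-! ### Integral representation of the Cesàro means -/

theorem sum_exp_eq_dirichletKernel (m : ℕ) (t : ℝ) :
    ∑ k ∈ Finset.Icc (-(m : ℤ)) (m : ℤ), Complex.exp (k * t * Complex.I) =
      (dirichletKernel m t : ℂ) := by
  induction m with
  | zero => simp [dirichletKernel]
  | succ m ih =>
    have e : Finset.Icc (-((m + 1 : ℕ) : ℤ)) ((m + 1 : ℕ) : ℤ) =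
        insert (-((m + 1 : ℕ) : ℤ)) (insert ((m + 1 : ℕ) : ℤ) (Finset.Icc (-(m : ℤ)) (m : ℤ))) := by
      ext k
      simp only [Finset.mem_Icc, Finset.mem_insert]
      omega
    rw [e, Finset.sum_insert (by simp; omega), Finset.sum_insert (by simp), ih]
    simp only [dirichletKernel, Finset.sum_range_succ]
    push_cast
    rw [mul_add 2, ← add_assoc, ← add_assoc, Complex.two_cos]
    ring_nf

theorem intervalIntegrable_of_integrable_haarAddCircle {f : Torus → ℂ}
    (hf : Integrable f (AddCircle.haarAddCircle : Measure Torus)) (a b : ℝ) :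
    IntervalIntegrable (fun t : ℝ => f (t : Torus)) volume a b := by
  have hvol : Integrable f (volume : Measure Torus) := by
    rw [AddCircle.volume_eq_smul_haarAddCircle]
    exact hf.smul_measure ENNReal.ofReal_ne_top
  have hper : Function.Periodic (fun t : ℝ => f (t : Torus)) (2 * Real.pi) := fun t => by
    simp only [AddCircle.coe_add_period]
  refine hper.intervalIntegrable Real.two_pi_pos.ne' (t := 0) ?_ a b
  rw [intervalIntegrable_iff_integrableOn_Ioc_of_le (by linarith [Real.two_pi_pos])]
  exact (AddCircle.measurePreserving_mk (2 * Real.pi) 0).integrable_comp_of_integrable hvol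

/-- The period is centred at `x`, so that `|x - y| ≤ π`, the range of the kernel estimates. -/
theorem fourierPartialSum_eq_integral {f : Torus → ℂ}
    (hf : Integrable f (AddCircle.haarAddCircle : Measure Torus)) (m : ℕ) (x : ℝ) :
    fourierPartialSum f m x = (1 / (2 * Real.pi) : ℝ) *
      ∫ y in (x - Real.pi)..(x + Real.pi), (dirichletKernel m (x - y) : ℂ) * f (y : Torus) := by
  have hfi := intervalIntegrable_of_integrable_haarAddCircle hf (x - Real.pi) (x + Real.pi)
  have h : ∀ k : ℤ, fourierCoeff f k * fourier k (x : Torus) = (1 / (2 * Real.pi) : ℝ) *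
      ∫ y in (x - Real.pi)..(x + Real.pi),
        Complex.exp (k * ((x - y : ℝ) : ℂ) * Complex.I) * f (y : Torus) := by
    intro k
    rw [fourierCoeff_eq_intervalIntegral f k (x - Real.pi),
      show x - Real.pi + 2 * Real.pi = x + Real.pi by ring, Complex.real_smul, mul_assoc,
      ← intervalIntegral.integral_mul_const]
    congr 1
    refine intervalIntegral.integral_congr fun y _ => ?_
    simp only [smul_eq_mul, fourier_coe_apply]
    rw [mul_right_comm, ← Complex.exp_add]
    congr 2
    have : (Real.pi : ℂ) ≠ 0 := by exact_mod_cast Real.pi_ne_zero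
    push_cast
    field_simp
    ring
  simp only [fourierPartialSum, h]
  rw [← Finset.mul_sum, ← intervalIntegral.integral_finsetSum]
  · congr 1
    refine intervalIntegral.integral_congr fun y _ => ?_
    simp only [← Finset.sum_mul, sum_exp_eq_dirichletKernel]
  · intro k _
    exact hfi.continuousOn_mul (Continuous.continuousOn (by fun_prop))

theorem continuous_dirichletKernel (m : ℕ) : Continuous (dirichletKernel m) := by
  unfold dirichletKernel; fun_prop

theorem cesaroMean_fourierPartialSum_eq_integral {a : ℝ} {f : Torus → ℂ}
    (hf : Integrable f (AddCircle.haarAddCircle : Measure Torus)) (n : ℕ) (x : ℝ) :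
    cesaroMean a (fun m => fourierPartialSum f m x) n = (1 / (2 * Real.pi) : ℝ) *
      ∫ y in (x - Real.pi)..(x + Real.pi), (cesaroKernel a n (x - y) : ℂ) * f (y : Torus) := by
  have hfi := intervalIntegrable_of_integrable_haarAddCircle hf (x - Real.pi) (x + Real.pi)
  simp only [cesaroMean, fourierPartialSum_eq_integral hf, mul_left_comm _ ((1 / _ : ℝ) : ℂ)]
  rw [← Finset.mul_sum, mul_div_assoc]
  congr 1
  simp only [← intervalIntegral.integral_const_mul]
  rw [← intervalIntegral.integral_finsetSum, ← intervalIntegral.integral_div]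
  · refine intervalIntegral.integral_congr fun y _ => ?_
    simp only [cesaroKernel, cesaroDirichletSum]
    push_cast
    rw [div_mul_eq_mul_div, Finset.sum_mul]
    simp only [mul_assoc]
  · intro m _
    refine (hfi.continuousOn_mul (Continuous.continuousOn ?_)).const_mul _
    exact Complex.continuous_ofReal.comp
      ((continuous_dirichletKernel m).comp (continuous_const.sub continuous_id))

theorem fourierPartialSum_add_const {f : Torus → ℂ}
    (hf : Integrable f (AddCircle.haarAddCircle : Measure Torus)) (d : ℂ) (m : ℕ) (x : ℝ) :
    fourierPartialSum (fun t => f t + d) m x = fourierPartialSum f m x + d := by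
  have hc : ∀ k : ℤ, fourierCoeff (fun t : Torus => f t + d) k =
      fourierCoeff f k + d * (Pi.single 0 1 : ℤ → ℂ) k := by
    intro k
    have e : (fun _ : Torus => d) = fun t => d * (fourier 0 : C(Torus, ℂ)) t := by
      funext t; simp
    have h := congrFun (fourierCoeff.add hf (integrable_const d)) k
    rw [e, Pi.add_apply, fourierCoeff.const_mul, fourierCoeff_fourier] at h
    rw [← h]
    congr 1
    funext t
    simp
  simp only [fourierPartialSum, hc, add_mul, Finset.sum_add_distrib]
  congr 1
  rw [Finset.sum_eq_single 0]
  · simp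
  · intro k _ hk
    simp [hk]
  · intro h
    simp at h

theorem cesaroMean_add_const {a : ℝ} (ha : -1 < a) (s : ℕ → ℂ) (d : ℂ) (n : ℕ) :
    cesaroMean a (fun m => s m + d) n = cesaroMean a s n + d := by
  have hA : (cesaroNumber a n : ℂ) ≠ 0 := by exact_mod_cast (cesaroNumber_pos ha n).ne'
  simp only [cesaroMean, mul_add, Finset.sum_add_distrib, ← Finset.sum_mul]
  rw [add_div, ← Complex.ofReal_sum, sum_cesaroNumber_reflect, mul_div_cancel_left₀ _ hA]

/-! ### Integration by parts and the limit for orders in `(1, 2]` -/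

/-- As `φ` is merely integrable, its primitive is absolutely continuous with derivative `φ` almost
everywhere; this suffices for integration by parts. -/
theorem integral_mul_eq_sub_integral_deriv_mul_real {k φ : ℝ → ℝ} (hk : ContDiff ℝ 1 k)
    {a b c : ℝ} (hφ : IntervalIntegrable φ volume a b) (hc : c ∈ Set.uIcc a b) :
    ∫ y in a..b, k y * φ y = k b * (∫ v in c..b, φ v) - k a * (∫ v in c..a, φ v) -
      ∫ y in a..b, deriv k y * ∫ v in c..y, φ v := by
  have hkac : AbsolutelyContinuousOnInterval k a b :=
    hk.contDiffOn.absolutelyContinuousOnInterval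
  have hΦ := hφ.absolutelyContinuousOnInterval_intervalIntegral hc
  rw [← hkac.integral_mul_deriv_eq_deriv_mul hΦ]
  refine intervalIntegral.integral_congr_ae ?_
  filter_upwards [hφ.ae_hasDerivAt_integral] with y hy hyab
  rw [(hy (Set.uIoc_subset_uIcc hyab) c hc).deriv]

theorem integral_ofReal_mul_eq_sub_integral_deriv_mul {k : ℝ → ℝ} {φ : ℝ → ℂ}
    (hk : ContDiff ℝ 1 k) {a b c : ℝ} (hφ : IntervalIntegrable φ volume a b)
    (hc : c ∈ Set.uIcc a b) :
    ∫ y in a..b, (k y : ℂ) * φ y = k b * (∫ v in c..b, φ v) - k a * (∫ v in c..a, φ v) -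
      ∫ y in a..b, ((deriv k y : ℝ) : ℂ) * ∫ v in c..y, φ v := by
  have hsub : ∀ y ∈ Set.uIcc a b, IntervalIntegrable φ volume c y := fun y hy =>
    hφ.mono_set (Set.uIcc_subset_uIcc hc hy)
  have hkφ : IntervalIntegrable (fun y => (k y : ℂ) * φ y) volume a b :=
    hφ.continuousOn_mul (Complex.continuous_ofReal.comp hk.continuous).continuousOn
  have hcont : ContinuousOn (fun y => ∫ v in c..y, φ v) (Set.uIcc a b) := by
    have := intervalIntegral.continuousOn_primitive_interval' hφ hc
    exact this
  have hdk : Continuous fun y => ((deriv k y : ℝ) : ℂ) :=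
    Complex.continuous_ofReal.comp (hk.continuous_deriv le_rfl)
  have hdkΦ : IntervalIntegrable (fun y => ((deriv k y : ℝ) : ℂ) * ∫ v in c..y, φ v) volume a b :=
    (hdk.continuousOn.mul hcont).intervalIntegrable
  -- The real case is applied to the real and imaginary parts at once, as `k` is real.
  have comm : ∀ (L : ℂ →L[ℝ] ℝ), (∀ (r : ℝ) (z : ℂ), L (r * z) = r * L z) →
      L (∫ y in a..b, (k y : ℂ) * φ y) =
        L (k b * (∫ v in c..b, φ v) - k a * (∫ v in c..a, φ v) -
          ∫ y in a..b, ((deriv k y : ℝ) : ℂ) * ∫ v in c..y, φ v) := by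
    intro L hL
    have hLφ : IntervalIntegrable (fun y => L (φ y)) volume a b :=
      ⟨L.integrable_comp hφ.1, L.integrable_comp hφ.2⟩
    rw [map_sub, map_sub, hL, hL, ← L.intervalIntegral_comp_comm hkφ,
      ← L.intervalIntegral_comp_comm hdkΦ,
      ← L.intervalIntegral_comp_comm (hsub b Set.right_mem_uIcc),
      ← L.intervalIntegral_comp_comm (hsub a Set.left_mem_uIcc)]
    simp only [hL]
    rw [integral_mul_eq_sub_integral_deriv_mul_real hk hLφ hc]
    congr 1
    refine intervalIntegral.integral_congr fun y hy => ?_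
    simp only [L.intervalIntegral_comp_comm (hsub y hy)]
  exact Complex.ext (comm Complex.reCLM (by simp)) (comm Complex.imCLM (by simp))

theorem tendsto_integral_deriv_cesaroKernel_mul {a : ℝ} (ha : 1 < a) (ha2 : a ≤ 2) {G : ℝ → ℂ}
    {x : ℝ} (hG : Continuous G) (hGx : G x = 0) (hG' : HasDerivAt G 0 x) :
    Tendsto (fun n : ℕ => ∫ y in (x - Real.pi)..(x + Real.pi),
      ((deriv (cesaroKernel a n) (x - y) : ℝ) : ℂ) * G y) atTop (𝓝 0) := by
  have hπ := Real.pi_pos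
  obtain ⟨C, hC, hbound⟩ := exists_abs_deriv_cesaroKernel_le ha ha2
  -- `G(x + u) = u H(x + u)` with `H` continuous and `H x = 0`: this is the only use of the
  -- derivative of `G` at `x`.
  set H := dslope G x with hH
  have hHc : Continuous H := by
    rw [← continuousOn_univ, hH, continuousOn_dslope univ_mem]
    exact ⟨hG.continuousOn, hG'.differentiableAt⟩
  have hHx : H x = 0 := by rw [hH, dslope_same, hG'.deriv]
  have hGH : ∀ u, G (x + u) = u * H (x + u) := fun u => by
    have := sub_smul_dslope G x (x + u)
    rw [hGx, sub_zero, add_sub_cancel_left, Complex.real_smul] at this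
    exact this.symm
  obtain ⟨M, hM⟩ := (isCompact_Icc (a := x - Real.pi) (b := x + Real.pi)).exists_bound_of_continuousOn
    hHc.continuousOn
  -- The integrand after `y = x + v/n`, extended by zero so that dominated convergence runs over all
  -- of `ℝ`.
  set F : ℕ → ℝ → ℂ := fun n => (Set.Ioc (-(n * Real.pi)) (n * Real.pi)).indicator fun v =>
    ((n : ℝ)⁻¹ : ℝ) * (((deriv (cesaroKernel a n) (-(v / n)) : ℝ) : ℂ) * G (x + v / n)) with hF
  have hFle : ∀ n v, ‖F n v‖ ≤ (Set.Ioc (-(n * Real.pi)) (n * Real.pi)).indicator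
      (fun v => C * (1 + ‖v‖) ^ (-a) * ‖H (x + v / n)‖) v := by
    intro n v
    rw [hF]
    simp only [norm_indicator_eq_indicator_norm]
    by_cases hv : v ∈ Set.Ioc (-(n * Real.pi)) (n * Real.pi)
    · rw [Set.indicator_of_mem hv, Set.indicator_of_mem hv]
      have hn : (0 : ℝ) < n := by
        rcases n.eq_zero_or_pos with rfl | h
        · simp at hv
        · exact_mod_cast h
      have hvn : |-(v / n)| = |v| / n := by rw [abs_neg, abs_div, Nat.abs_cast]
      have hvle : |-(v / n)| ≤ Real.pi := by
        rw [hvn, div_le_iff₀ hn, mul_comm, abs_le]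
        exact ⟨hv.1.le, hv.2⟩
      have hd := hbound n _ hvle
      rw [hvn, mul_div_cancel₀ _ hn.ne'] at hd
      rw [hGH, norm_mul, norm_mul, norm_mul, Complex.norm_real, Complex.norm_real,
        Complex.norm_real, Real.norm_eq_abs, Real.norm_eq_abs, Real.norm_eq_abs, Real.norm_eq_abs,
        abs_div, Nat.abs_cast, abs_of_pos (inv_pos.mpr hn)]
      -- The factor `|v|` coming from `G` costs one power of decay; what remains is integrable as `a
      -- > 1`.
      have hpow : |v| * (1 + |v|) ^ (-(a + 1)) ≤ (1 + |v|) ^ (-a) := by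
        have hp : 0 < 1 + |v| := by positivity
        have e : (1 + |v|) ^ (-a) = (1 + |v|) * (1 + |v|) ^ (-(a + 1)) := by
          rw [show -a = 1 + -(a + 1) by ring, Real.rpow_add hp, Real.rpow_one]
        rw [e]
        gcongr
        linarith
      calc (n : ℝ)⁻¹ * (|deriv (cesaroKernel a n) (-(v / n))| * (|v| / n * ‖H (x + v / n)‖))
          ≤ (n : ℝ)⁻¹ * (C * (n : ℝ) ^ 2 * (1 + |v|) ^ (-(a + 1)) *
            (|v| / n * ‖H (x + v / n)‖)) := by gcongr
        _ = C * (|v| * (1 + |v|) ^ (-(a + 1))) * ‖H (x + v / n)‖ := by field_simp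
        _ ≤ C * (1 + |v|) ^ (-a) * ‖H (x + v / n)‖ := by gcongr
    · rw [Set.indicator_of_notMem hv, Set.indicator_of_notMem hv]
  have hlim : Tendsto (fun n => ∫ v, F n v) atTop (𝓝 (∫ _ : ℝ, (0 : ℂ))) := by
    refine tendsto_integral_of_dominated_convergence (fun v => C * (1 + ‖v‖) ^ (-a) * M)
      (fun n => ?_) ?_ (fun n => Eventually.of_forall fun v => ?_)
      (Eventually.of_forall fun v => ?_)
    · have hd := (contDiff_cesaroKernel a n).continuous_deriv le_rfl
      refine (Continuous.aestronglyMeasurable ?_).indicator measurableSet_Ioc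
      fun_prop
    · refine ((integrable_one_add_norm ?_).const_mul C).mul_const M
      simpa using ha
    · refine (hFle n v).trans ?_
      have hM0 : 0 ≤ M := (norm_nonneg _).trans (hM x ⟨by linarith, by linarith⟩)
      refine Set.indicator_apply_le' (fun hv => ?_) fun _ => by positivity
      gcongr
      refine hM _ ?_
      -- For `n = 0` the convention `v / 0 = 0` makes the point `x` itself.
      rcases n.eq_zero_or_pos with rfl | hn
      · simp only [Nat.cast_zero, div_zero, add_zero]
        exact ⟨by linarith, by linarith⟩
      · have hn' : (0 : ℝ) < n := by exact_mod_cast hn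
        have h1 : -Real.pi ≤ v / n := by rw [le_div_iff₀ hn']; linarith [hv.1]
        have h2 : v / n ≤ Real.pi := by rw [div_le_iff₀ hn']; linarith [hv.2]
        exact ⟨by linarith, by linarith⟩
    · have hH0 : Tendsto (fun n : ℕ => C * (1 + ‖v‖) ^ (-a) * ‖H (x + v / n)‖) atTop (𝓝 0) := by
        have h1 : Tendsto (fun n : ℕ => x + v / n) atTop (𝓝 x) := by
          simpa using (tendsto_const_div_atTop_nhds_zero_nat v).const_add x
        have h2 := ((hHc.tendsto x).comp h1).norm.const_mul (C * (1 + ‖v‖) ^ (-a))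
        simpa [hHx] using h2
      refine squeeze_zero_norm (fun n => (hFle n v).trans ?_) hH0
      exact Set.indicator_le_self' (fun _ _ => by positivity) v
  rw [integral_zero] at hlim
  refine hlim.congr' ?_
  filter_upwards [eventually_gt_atTop 0] with n hn
  have hn' : (n : ℝ) ≠ 0 := by exact_mod_cast hn.ne'
  have hnn : -(n * Real.pi) ≤ n * Real.pi := by
    have : 0 ≤ n * Real.pi := by positivity
    linarith
  rw [hF]
  simp only
  rw [integral_indicator measurableSet_Ioc, ← intervalIntegral.integral_of_le hnn,
    intervalIntegral.integral_const_mul]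
  rw [intervalIntegral.integral_comp_div
    (fun u => ((deriv (cesaroKernel a n) (-u) : ℝ) : ℂ) * G (x + u)) hn']
  have e := intervalIntegral.integral_comp_add_left (a := -Real.pi) (b := Real.pi)
    (fun y => ((deriv (cesaroKernel a n) (x - y) : ℝ) : ℂ) * G y) x
  simp only [sub_add_cancel_left] at e
  rw [← sub_eq_add_neg] at e
  rw [← e, Complex.real_smul, ← mul_assoc, ← Complex.ofReal_mul, inv_mul_cancel₀ hn', neg_div,
    mul_div_cancel_left₀ _ hn']
  simp

theorem tendsto_cesaroKernel_of_cos_eq {a : ℝ} (ha : 1 < a) {t : ℝ} (ht : Real.cos t = -1) :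
    Tendsto (fun n => (cesaroKernel a n t : ℂ)) atTop (𝓝 0) := by
  refine squeeze_zero_norm (fun n => ?_)
    ((tendsto_const_nhds (x := a)).div_atTop
      (tendsto_atTop_add_const_left _ a tendsto_natCast_atTop_atTop))
  rw [Complex.norm_real]
  exact abs_cesaroKernel_pi_le ha ht

theorem tendsto_cesaroMean_of_isDPoint_zero {a : ℝ} (ha : 1 < a) (ha2 : a ≤ 2) {f : Torus → ℂ}
    (hf : Integrable f (AddCircle.haarAddCircle : Measure Torus)) {x : ℝ}
    (hx : IsDPoint f x 0) :
    Tendsto (cesaroMean a fun m => fourierPartialSum f m x) atTop (𝓝 0) := by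
  have hπ := Real.pi_pos
  have hfi := intervalIntegrable_of_integrable_haarAddCircle hf
  -- Basing the primitive at `x` gives `G x = 0`, hence `G(x + u) = o(u)`.
  set G : ℝ → ℂ := fun y => ∫ t in x..y, f (t : Torus) with hGdef
  have hG : Continuous G := intervalIntegral.continuous_primitive hfi x
  have hGx : G x = 0 := intervalIntegral.integral_same
  have hG' : HasDerivAt G 0 x := by
    have e : G = fun y => (∫ t in (0 : ℝ)..y, f (t : Torus)) - ∫ t in (0 : ℝ)..x, f (t : Torus) := by
      funext y
      exact (intervalIntegral.integral_interval_sub_left (hfi 0 y) (hfi 0 x)).symm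
    rw [e]
    exact hx.sub_const _
  have hparts : ∀ n, cesaroMean a (fun m => fourierPartialSum f m x) n =
      (1 / (2 * Real.pi) : ℝ) * (cesaroKernel a n (-Real.pi) * G (x + Real.pi) -
        cesaroKernel a n Real.pi * G (x - Real.pi) +
        ∫ y in (x - Real.pi)..(x + Real.pi),
          ((deriv (cesaroKernel a n) (x - y) : ℝ) : ℂ) * G y) := by
    intro n
    have hK := contDiff_cesaroKernel a n
    have hk : ContDiff ℝ 1 fun y => cesaroKernel a n (x - y) := by fun_prop
    rw [cesaroMean_fourierPartialSum_eq_integral hf,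
      integral_ofReal_mul_eq_sub_integral_deriv_mul hk (hfi _ _) (c := x)
        (by rw [Set.mem_uIcc]; left; constructor <;> linarith)]
    simp only [deriv_comp_const_sub, Complex.ofReal_neg, neg_mul, intervalIntegral.integral_neg,
      sub_neg_eq_add, sub_add_cancel_left, sub_sub_cancel, hGdef]
  have h1 := (tendsto_cesaroKernel_of_cos_eq ha (t := -Real.pi) (by simp)).mul_const (G (x + Real.pi))
  have h2 := (tendsto_cesaroKernel_of_cos_eq ha Real.cos_pi).mul_const (G (x - Real.pi))
  have h3 := tendsto_integral_deriv_cesaroKernel_mul ha ha2 hG hGx hG'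
  have h := ((h1.sub h2).add h3).const_mul ((1 / (2 * Real.pi) : ℝ) : ℂ)
  simp only [zero_mul, sub_zero, add_zero, mul_zero] at h
  exact h.congr fun n => (hparts n).symm

/-! ### Arbitrary values of `d` and all orders above `1` -/

theorem IsDPoint.sub_const {f : Torus → ℂ}
    (hf : Integrable f (AddCircle.haarAddCircle : Measure Torus)) {x : ℝ} {d : ℂ}
    (hx : IsDPoint f x d) : IsDPoint (fun t => f t - d) x 0 := by
  have h := HasDerivAt.sub hx ((hasDerivAt_id x).smul_const d)
  simp only [one_smul, sub_self] at h
  refine h.congr_of_eventuallyEq (Eventually.of_forall fun y => ?_)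
  have := intervalIntegral.integral_sub (μ := volume)
    (intervalIntegrable_of_integrable_haarAddCircle hf 0 y)
    (intervalIntegrable_const (c := d))
  simpa using this

theorem tendsto_cesaroMean_of_isDPoint {f : Torus → ℂ}
    (hf : Integrable f (AddCircle.haarAddCircle : Measure Torus)) {x : ℝ} {d : ℂ}
    (hx : IsDPoint f x d) {a : ℝ} (ha : 1 < a) (ha2 : a ≤ 2) :
    Tendsto (cesaroMean a fun m => fourierPartialSum f m x) atTop (𝓝 d) := by
  have hg : Integrable (fun t => f t - d) (AddCircle.haarAddCircle : Measure Torus) :=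
    hf.sub (integrable_const d)
  have h := (tendsto_cesaroMean_of_isDPoint_zero ha ha2 hg (hx.sub_const hf)).add_const d
  rw [zero_add] at h
  refine h.congr fun n => ?_
  rw [← cesaroMean_add_const (by linarith)]
  simp only [← fourierPartialSum_add_const hg, sub_add_cancel]

theorem corollary3 (α : ℝ) (hα : 1 < α) (f : Torus → ℂ)
    (hf : Integrable f (AddCircle.haarAddCircle : Measure Torus))
    (x : ℝ) (d : ℂ) (hx : IsDPoint f x d) :
    Tendsto (fun n : ℕ => cesaroMean α (fun m => fourierPartialSum f m x) n) atTop (𝓝 d) := by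
  -- Induction over unit steps in the order: if `a > 2` then `a - 1 > 1` is covered by the previous
  -- stage.
  have key : ∀ k : ℕ, ∀ a : ℝ, 1 < a → a ≤ k + 2 →
      Tendsto (cesaroMean a fun m => fourierPartialSum f m x) atTop (𝓝 d) := by
    intro k
    induction k with
    | zero =>
      intro a ha ha2
      exact tendsto_cesaroMean_of_isDPoint hf hx ha (by simpa using ha2)
    | succ k ih =>
      intro a ha hak
      push_cast at hak
      rcases le_or_gt a 2 with h2 | h2
      · exact tendsto_cesaroMean_of_isDPoint hf hx ha h2
      · have := tendsto_cesaroMean_add_one (by linarith)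
          (ih (a - 1) (by linarith) (by linarith))
        rwa [sub_add_cancel] at this
  obtain ⟨k, hk⟩ := exists_nat_ge α
  exact key k α hα (by linarith)
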